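/- Let $m \ge 0$ and let $A$ be an $m\times m$ integer matrix. For $n \in \mathbb{N} = \{0,1,2,\dots\}$ let $S_n$ be the Smith form of $A^n$ normalized to have nonnegative diagonal entries, i.e. the unique diagonal integer matrix with nonnegative diagonal entries such that $(S_n)_{ii}$ divides $(S_n)_{i+1,i+1}$ for $1 \le i < m$ and $A^n = U S_n V$ for some integer matrices $U, V$ of determinant $\pm 1$. (Such a matrix exists and is unique.) Then there is a sequence $(D_n)_{n\in\mathbb{N}}$ of diagonal $m\times m$ integer matrices such that $S_{n+1} = D_n S_n$ for all $n \in \mathbb{N}$ and such that $(D_n)_n$ is eventually periodic: there exist $n_0 \in \mathbb{N}$ and an integer $T \ge 1$ with $D_{n+T} = D_n$ for all $n \ge n_0$. -/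

import Mathlib

/-- `S` is the Smith form of the square integer matrix `M`, normalized to have nonnegative
diagonal entries: `S` is diagonal with nonnegative diagonal entries, each diagonal entry divides
the next one, and `M = U * S * V` for some unimodular integer matrices `U` and `V`. -/
structure IsSmithForm {m : ℕ} (M S : Matrix (Fin m) (Fin m) ℤ) : Prop where
  isDiag : S.IsDiag
  nonneg : ∀ i, 0 ≤ S i i
  dvd : ∀ i j : Fin m, (i : ℕ) + 1 = (j : ℕ) → S i i ∣ S j j
  equiv : ∃ U V : Matrix (Fin m) (Fin m) ℤ, IsUnit U.det ∧ IsUnit V.det ∧ M = U * S * V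

/-- A sequence is eventually periodic if `f (n + T) = f n` for all `n ≥ n₀`, for some threshold
`n₀` and some period `T > 0`. -/
def EventuallyPeriodic {α : Type*} (f : ℕ → α) : Prop :=
  ∃ n₀ T : ℕ, 0 < T ∧ ∀ n, n₀ ≤ n → f (n + T) = f n

open Polynomial in
theorem Matrix.isIntegral_charpoly_coeff {ι K : Type*} [Fintype ι] [DecidableEq ι] [Field K]
    [IsAlgClosed K] {M : Matrix ι ι K} (h : IsIntegral ℤ M) (i : ℕ) :
    IsIntegral ℤ (M.charpoly.coeff i) := by
  refine isIntegral_coeff_of_factors _ ?_ (IsAlgClosed.splits _) ?_ i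
  · rw [M.charpoly_monic.leadingCoeff]; exact isIntegral_one
  · intro x hx
    obtain ⟨p, hp, hpM⟩ := h
    refine ⟨p, hp, ?_⟩
    have hs := Matrix.mem_spectrum_of_isRoot_charpoly hx
    have := spectrum.subset_polynomial_aeval M (p.map (algebraMap ℤ K)) ⟨x, hs, rfl⟩
    have h0 : aeval M (p.map (algebraMap ℤ K)) = 0 := by
      rw [aeval_map_algebraMap]; exact hpM
    rw [h0] at this
    have hnt : Nontrivial (Matrix ι ι K) := by
      by_contra hn
      rw [not_nontrivial_iff_subsingleton] at hn
      rw [spectrum.of_subsingleton] at hs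
      exact hs
    rw [spectrum.zero_eq] at this
    simpa [eval_map] using this

open Polynomial in
theorem Matrix.isIntegral_of_charpoly_coeff {ι K : Type*} [Fintype ι] [DecidableEq ι] [Field K]
    {M : Matrix ι ι K} (h : ∀ i, IsIntegral ℤ (M.charpoly.coeff i)) : IsIntegral ℤ M := by
  obtain ⟨q, hq, -, hm⟩ :=
    lifts_and_natDegree_eq_and_monic (p := M.charpoly) (f := algebraMap (integralClosure ℤ K) _)
    (M.charpoly.lifts_iff_coeff_lifts.mpr (by simpa [mem_integralClosure_iff] using h))
    M.charpoly_monic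
  have : IsIntegral (integralClosure ℤ K) M := by
    refine ⟨q, hm, ?_⟩
    have := M.aeval_self_charpoly
    rw [← hq, aeval_map_algebraMap] at this
    exact this
  exact isIntegral_trans _ this

theorem isIntegral_inv_pow_mul_iff {γ : ℂ} {n g k : ℕ} (hn : 0 < n) (hg : g ≠ 0)
    (hγ : γ ^ n = g) (a : ℤ) : IsIntegral ℤ (γ⁻¹ ^ k * (a : ℂ)) ↔ (g : ℤ) ^ k ∣ a ^ n := by
  have hg' : (g : ℚ) ^ k ≠ 0 := by positivity
  rw [← IsIntegral.pow_iff hn]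
  have : (γ⁻¹ ^ k * (a : ℂ)) ^ n = algebraMap ℚ ℂ ((a : ℚ) ^ n / (g : ℚ) ^ k) := by
    rw [mul_pow, pow_right_comm, inv_pow, hγ]
    simp [div_eq_mul_inv, mul_comm]
  rw [this, isIntegral_algebraMap_iff (algebraMap ℚ ℂ).injective, IsIntegrallyClosed.isIntegral_iff]
  constructor
  · rintro ⟨y, hy⟩
    refine ⟨y, ?_⟩
    rw [eq_div_iff hg'] at hy
    simp only [eq_intCast] at hy
    have : (y : ℚ) * g ^ k = a ^ n := hy
    have : y * (g : ℤ) ^ k = a ^ n := by exact_mod_cast this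
    rw [← this, mul_comm]
  · rintro ⟨y, hy⟩
    refine ⟨y, ?_⟩
    rw [eq_div_iff hg', eq_intCast]
    have : y * (g : ℤ) ^ k = a ^ n := by rw [hy, mul_comm]
    exact_mod_cast this

/-- The complexification of an integer matrix. -/
noncomputable abbrev Matrix.toComplex {ι : Type*} [Fintype ι] [DecidableEq ι] :
    Matrix ι ι ℤ →+* Matrix ι ι ℂ := (Int.castRingHom ℂ).mapMatrix

theorem Matrix.toComplex_injective {ι : Type*} [Fintype ι] [DecidableEq ι] :
    Function.Injective (Matrix.toComplex (ι := ι)) :=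
  Matrix.map_injective Int.cast_injective

theorem Matrix.isIntegral_smul_toComplex_iff {ι : Type*} [Fintype ι] [DecidableEq ι] (γ : ℂ)
    (B : Matrix ι ι ℤ) : IsIntegral ℤ (γ • B.toComplex) ↔
      ∀ k ≤ Fintype.card ι,
        IsIntegral ℤ (γ ^ k * (B.charpoly.coeff (Fintype.card ι - k) : ℂ)) := by
  have key : ∀ k ≤ Fintype.card ι, (γ • B.toComplex).charpoly.coeff (Fintype.card ι - k) =
      γ ^ k * (B.charpoly.coeff (Fintype.card ι - k) : ℂ) := by
    intro k hk
    rw [Matrix.charpoly_coeff_eq_sum_minors _ k hk, Matrix.charpoly_coeff_eq_sum_minors _ k hk]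
    push_cast
    rw [mul_left_comm, Finset.mul_sum (a := γ ^ k)]
    congr 1
    refine Finset.sum_congr rfl fun s hs => ?_
    change (γ • B.toComplex.submatrix (Subtype.val : s → ι) (Subtype.val : s → ι)).det = _
    rw [Matrix.det_smul, Fintype.card_coe, (Finset.mem_powersetCard.mp hs).2]
    rfl
  constructor
  · intro h k hk
    rw [← key k hk]
    exact Matrix.isIntegral_charpoly_coeff h _
  · intro h
    refine Matrix.isIntegral_of_charpoly_coeff fun i => ?_
    by_cases hi : i ≤ Fintype.card ι
    · have := key (Fintype.card ι - i) (Nat.sub_le _ _)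
      rw [Nat.sub_sub_self hi] at this
      rw [this]
      simpa [Nat.sub_sub_self hi] using h (Fintype.card ι - i) (Nat.sub_le _ _)
    · rw [Polynomial.coeff_eq_zero_of_natDegree_lt]
      · exact isIntegral_zero
      · rw [Matrix.charpoly_natDegree_eq_dim]; omega

theorem Matrix.isIntegral_inv_smul_pow {ι : Type*} [Fintype ι] [DecidableEq ι]
    (B : Matrix ι ι ℤ) {e c : ℕ} (he : 0 < e) (hc : c ≠ 0)
    (h : ∀ k ≤ Fintype.card ι, (c : ℤ) ^ k ∣ B.charpoly.coeff (Fintype.card ι - k) ^ e) :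
    IsIntegral ℤ ((c : ℂ)⁻¹ • (B ^ e).toComplex) := by
  obtain ⟨γ, hγ⟩ := IsAlgClosed.exists_pow_nat_eq (c : ℂ) he
  have : IsIntegral ℤ (γ⁻¹ • B.toComplex) := by
    rw [Matrix.isIntegral_smul_toComplex_iff]
    intro k hk
    rw [isIntegral_inv_pow_mul_iff he hc hγ]
    exact h k hk
  have h2 : (c : ℂ)⁻¹ • (B ^ e).toComplex = (γ⁻¹ • B.toComplex) ^ e := by
    rw [smul_pow, inv_pow, hγ, map_pow]
  rw [h2]
  exact IsIntegral.of_mem_of_fg (Algebra.adjoin ℤ {γ⁻¹ • B.toComplex})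
    this.fg_adjoin_singleton _
    (Subalgebra.pow_mem _ (Algebra.self_mem_adjoin_singleton _ _) _)

theorem Matrix.pow_dvd_charpoly_coeff_pow {ι : Type*} [Fintype ι] [DecidableEq ι]
    (B M : Matrix ι ι ℤ) {n g : ℕ} (hn : 0 < n) (hg : g ≠ 0) (h : B ^ n = (g : ℤ) • M)
    (k : ℕ) (hk : k ≤ Fintype.card ι) :
    (g : ℤ) ^ k ∣ B.charpoly.coeff (Fintype.card ι - k) ^ n := by
  obtain ⟨γ, hγ⟩ := IsAlgClosed.exists_pow_nat_eq (g : ℂ) hn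
  rw [← isIntegral_inv_pow_mul_iff hn hg hγ]
  refine (Matrix.isIntegral_smul_toComplex_iff γ⁻¹ B).1 ?_ k hk
  refine IsIntegral.of_pow hn ?_
  have : (γ⁻¹ • B.toComplex) ^ n = M.toComplex := by
    rw [smul_pow, inv_pow, hγ, ← map_pow, h]
    ext i j
    have : (g : ℂ) ≠ 0 := by exact_mod_cast hg
    change (g : ℂ)⁻¹ * (((g : ℤ) * M i j : ℤ) : ℂ) = (M i j : ℂ)
    push_cast
    rw [inv_mul_cancel_left₀ this]
  rw [this]
  exact (Matrix.isIntegral M).map (Matrix.toComplex (ι := ι)).toIntAlgHom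

theorem eventuallyPeriodic_of_succ_eq {α : Type*} [Finite α] {s : ℕ → α} (F : α → α)
    (h : ∀ n, s (n + 1) = F (s n)) : EventuallyPeriodic s := by
  obtain ⟨a, b, hab, he⟩ := Finite.exists_ne_map_eq_of_infinite s
  wlog hlt : a < b generalizing a b
  · exact this b a hab.symm he.symm (by omega)
  refine ⟨a, b - a, by omega, fun n hn => ?_⟩
  induction n, hn using Nat.le_induction with
  | base => rw [he]; congr 1; omega
  | succ n _ ih => rw [add_right_comm, h, ih, h]

theorem Finset.gcd_pow_nat {β : Type*} (s : Finset β) (f : β → ℕ) (n : ℕ) (hs : s.Nonempty) :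
    s.gcd (fun b => f b ^ n) = s.gcd f ^ n := by
  classical
  induction hs using Finset.Nonempty.cons_induction with
  | singleton a => simp
  | cons a s ha hs ih =>
    rw [Finset.cons_eq_insert, Finset.gcd_insert, Finset.gcd_insert, ih]
    exact Nat.pow_gcd_pow

namespace Matrix

variable {ι κ l : Type*} [Fintype ι] [Fintype κ] [Fintype l]

/-- The greatest common divisor of the entries of an integer matrix. -/
def content (M : Matrix ι κ ℤ) : ℕ :=
  Finset.univ.gcd fun p : ι × κ => (M p.1 p.2).natAbs

theorem dvd_content_iff {M : Matrix ι κ ℤ} {d : ℕ} :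
    d ∣ M.content ↔ ∀ i j, (d : ℤ) ∣ M i j := by
  simp [content, Finset.dvd_gcd_iff, Int.natCast_dvd]

theorem content_dvd (M : Matrix ι κ ℤ) (i : ι) (j : κ) : (M.content : ℤ) ∣ M i j :=
  dvd_content_iff.1 dvd_rfl i j

theorem content_eq_zero_iff {M : Matrix ι κ ℤ} : M.content = 0 ↔ M = 0 := by
  simp [content, Finset.gcd_eq_zero_iff, ← Matrix.ext_iff]

theorem content_dvd_content_mul_left (M : Matrix ι κ ℤ) (N : Matrix κ l ℤ) :
    M.content ∣ (M * N).content :=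
  dvd_content_iff.2 fun _ _ => Finset.dvd_sum fun _ _ => (content_dvd M _ _).mul_right _

theorem content_dvd_content_mul_right (M : Matrix ι κ ℤ) (N : Matrix κ l ℤ) :
    N.content ∣ (M * N).content :=
  dvd_content_iff.2 fun _ _ => Finset.dvd_sum fun _ _ => (content_dvd N _ _).mul_left _

theorem content_smul (c : ℕ) (M : Matrix ι κ ℤ) : ((c : ℤ) • M).content = c * M.content := by
  simp only [content, smul_apply, smul_eq_mul, Int.natAbs_mul, Int.natAbs_natCast]
  rw [Finset.gcd_mul_left]
  simp

theorem exists_eq_content_smul (M : Matrix ι κ ℤ) :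
    ∃ N : Matrix ι κ ℤ, M = (M.content : ℤ) • N := by
  choose N hN using content_dvd M
  exact ⟨N, by ext i j; exact hN i j⟩

theorem content_dvd_content_of_forall_dvd_sub {M N : Matrix ι κ ℤ} {q : ℕ} (hM : M.content ∣ q)
    (h : ∀ i j, (q : ℤ) ∣ N i j - M i j) : M.content ∣ N.content :=
  dvd_content_iff.2 fun i j => by
    have := dvd_add ((Int.natCast_dvd_natCast.2 hM).trans (h i j)) (content_dvd M i j)
    rwa [sub_add_cancel] at this

variable [DecidableEq ι]

theorem exists_isIntegral_inv_smul_pow (B : Matrix ι ι ℤ) (hB : ∀ n, B ^ n ≠ 0) :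
    ∃ e c : ℕ, 0 < e ∧ c ≠ 0 ∧ IsIntegral ℤ ((c : ℂ)⁻¹ • (B ^ e).toComplex) ∧
      ∀ n, (B ^ (e * n)).content ∣ c ^ n := by
  set N := Fintype.card ι with hN
  set a : ℕ → ℕ := fun k => (B.charpoly.coeff (N - k)).natAbs with ha
  have hNpos : 0 < N := by
    rw [hN, Fintype.card_pos_iff]
    by_contra hne
    rw [not_nonempty_iff] at hne
    exact hB 0 (Subsingleton.elim _ _)
  set c := (Finset.Icc 1 N).gcd fun k => a k ^ (N.factorial / k) with hc
  have hdiv : ∀ k ∈ Finset.Icc 1 N, N.factorial / k * k = N.factorial := fun k hk => by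
    rw [Finset.mem_Icc] at hk
    exact Nat.div_mul_cancel (Nat.dvd_factorial hk.1 hk.2)
  have hc0 : c ≠ 0 := by
    intro h0
    rw [hc, Finset.gcd_eq_zero_iff] at h0
    have hcoeff : ∀ i < N, B.charpoly.coeff i = 0 := fun i hi => by
      have := eq_zero_of_pow_eq_zero (h0 (N - i) (Finset.mem_Icc.2 ⟨by omega, by omega⟩))
      rwa [ha, Int.natAbs_eq_zero, Nat.sub_sub_self hi.le] at this
    have hX : B.charpoly = Polynomial.X ^ N := by
      ext i
      rw [Polynomial.coeff_X_pow]
      split_ifs with hi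
      · rw [hi, hN, ← B.charpoly_natDegree_eq_dim]; exact B.charpoly_monic.coeff_natDegree
      · rcases lt_or_gt_of_ne hi with h | h
        · exact hcoeff i h
        · exact Polynomial.coeff_eq_zero_of_natDegree_lt (by rwa [B.charpoly_natDegree_eq_dim])
    apply hB N
    have := B.aeval_self_charpoly
    rwa [hX, map_pow, Polynomial.aeval_X] at this
  refine ⟨N.factorial, c, N.factorial_pos, hc0, ?_, ?_⟩
  · refine B.isIntegral_inv_smul_pow N.factorial_pos hc0 fun k hk => ?_
    rcases Nat.eq_zero_or_pos k with rfl | hk0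
    · simp
    have hmem : k ∈ Finset.Icc 1 N := Finset.mem_Icc.2 ⟨hk0, hk⟩
    have := pow_dvd_pow_of_dvd (Finset.gcd_dvd (f := fun k => a k ^ (N.factorial / k)) hmem) k
    rw [← pow_mul, hdiv k hmem] at this
    rw [← Int.natAbs_dvd_natAbs, Int.natAbs_pow, Int.natAbs_pow, Int.natAbs_natCast]
    exact this
  · intro n
    obtain ⟨M, hM⟩ := exists_eq_content_smul (B ^ (N.factorial * n))
    set g := (B ^ (N.factorial * n)).content with hg
    have hg0 : g ≠ 0 := fun h => hB _ (content_eq_zero_iff.1 h)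
    rcases Nat.eq_zero_or_pos n with rfl | hn
    · obtain ⟨i⟩ := Fintype.card_pos_iff.1 hNpos
      have := content_dvd (B ^ (N.factorial * 0)) i i
      rw [mul_zero, pow_zero, one_apply_eq] at this
      rw [hg, mul_zero, pow_zero, pow_zero]
      exact_mod_cast this
    rw [hc, ← Finset.gcd_pow_nat _ _ _ ⟨1, Finset.mem_Icc.2 ⟨le_rfl, hNpos⟩⟩]
    refine Finset.dvd_gcd fun k hk => ?_
    have hk' := Finset.mem_Icc.1 hk
    have := B.pow_dvd_charpoly_coeff_pow M (Nat.mul_pos N.factorial_pos hn) hg0 hM k hk'.2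
    rw [← Int.natAbs_dvd_natAbs, Int.natAbs_pow, Int.natAbs_pow, Int.natAbs_natCast] at this
    rw [← Nat.pow_dvd_pow_iff (n := k) (by omega), ← pow_mul, ← pow_mul, mul_comm n k,
      ← mul_assoc, hdiv k hk]
    exact this

theorem exists_recurrence (A : Matrix ι ι ℤ) {c : ℕ} (hc : c ≠ 0)
    (h : IsIntegral ℤ ((c : ℂ)⁻¹ • A.toComplex)) :
    ∃ (d : ℕ) (p : ℕ → ℤ) (X : ℕ → Matrix ι ι ℤ),
      (∀ n, ((c ^ n : ℕ) : ℤ) • X n = ((c ^ d : ℕ) : ℤ) • A ^ n) ∧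
      ∀ n, X (n + d) = ∑ i ∈ Finset.range d, p i • X (n + i) := by
  obtain ⟨P, hP, hPC⟩ := h
  set C := (c : ℂ)⁻¹ • A.toComplex with hC
  set d := P.natDegree with hd
  have hcC : (c : ℂ) ≠ 0 := by exact_mod_cast hc
  have hcpow : ∀ n, (c : ℂ) ^ n • C ^ n = (A ^ n).toComplex := fun n => by
    rw [hC, smul_pow, smul_smul, ← mul_pow, mul_inv_cancel₀ hcC, one_pow, one_smul, map_pow]
  have hrec : ∀ n, C ^ (n + d) = ∑ i ∈ Finset.range d, (-P.coeff i) • C ^ (n + i) := fun n => by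
    have h0 : C ^ d + ∑ i ∈ Finset.range d, P.coeff i • C ^ i = 0 := by
      have := hPC
      rw [← Polynomial.aeval_def, Polynomial.aeval_eq_sum_range, Finset.sum_range_succ, ← hd,
        hP.coeff_natDegree, one_smul, add_comm] at this
      exact this
    rw [pow_add, eq_neg_of_add_eq_zero_left h0, mul_neg, Finset.mul_sum, ← Finset.sum_neg_distrib]
    refine Finset.sum_congr rfl fun i _ => ?_
    rw [pow_add, mul_smul_comm, neg_smul]
  have hex : ∀ n, ∃ Y : Matrix ι ι ℤ, Y.toComplex = (c : ℂ) ^ d • C ^ n := fun n => by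
    induction n using Nat.strong_induction_on with
    | _ n ih =>
      rcases lt_or_ge n d with hlt | hge
      · refine ⟨((c ^ (d - n) : ℕ) : ℤ) • A ^ n, ?_⟩
        rw [map_zsmul, ← hcpow, ← Int.cast_smul_eq_zsmul ℂ, smul_smul]
        congr 1
        push_cast
        rw [← pow_add]; congr 1; omega
      · obtain ⟨m, rfl⟩ := Nat.exists_eq_add_of_le' hge
        choose! Y hY using ih
        refine ⟨∑ i ∈ Finset.range d, (-P.coeff i) • Y (m + i), ?_⟩
        rw [map_sum, hrec, Finset.smul_sum]
        refine Finset.sum_congr rfl fun i hi => ?_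
        rw [map_zsmul, hY _ (by have := Finset.mem_range.1 hi; omega), smul_comm]
  choose X hX using hex
  refine ⟨d, fun i => -P.coeff i, X, fun n => toComplex_injective ?_, fun n =>
    toComplex_injective ?_⟩
  · rw [map_zsmul, map_zsmul, hX, ← hcpow, ← Int.cast_smul_eq_zsmul ℂ, ← Int.cast_smul_eq_zsmul ℂ,
      smul_comm]
    push_cast; rfl
  · rw [map_sum, hX, hrec, Finset.smul_sum]
    refine Finset.sum_congr rfl fun i _ => ?_
    rw [map_zsmul, hX, smul_comm]

theorem eventuallyPeriodic_map_of_recurrence {q : ℕ} [NeZero q] {d : ℕ} {p : ℕ → ℤ}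
    {X : ℕ → Matrix ι ι ℤ} (h : ∀ n, X (n + d) = ∑ i ∈ Finset.range d, p i • X (n + i)) :
    EventuallyPeriodic fun n => (X n).map (Int.castRingHom (ZMod q)) := by
  set Y : ℕ → Matrix ι ι (ZMod q) := fun n => (Int.castRingHom (ZMod q)).mapMatrix (X n) with hY
  have hrec : ∀ n, Y (n + d) = ∑ i ∈ Finset.range d, p i • Y (n + i) := fun n => by
    simp only [hY, h, map_sum, map_zsmul]
  let s : ℕ → Fin (d + 1) → Matrix ι ι (ZMod q) := fun n i => Y (n + i)
  have hs : EventuallyPeriodic s := by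
    refine eventuallyPeriodic_of_succ_eq
      (fun t i => if hi : (i : ℕ) < d then t ⟨i + 1, by omega⟩ else
        ∑ j : Fin d, p j • t j.succ) fun n => ?_
    funext i
    by_cases hi : (i : ℕ) < d
    · simp only [s, hi, dif_pos]; congr 1; omega
    · have hid : (i : ℕ) = d := by omega
      change Y (n + 1 + i) = dite _ _ _
      rw [dif_neg hi, hid, hrec, Finset.sum_range]
      refine Finset.sum_congr rfl fun j _ => ?_
      congr 2; simp; omega
  obtain ⟨n₀, T, hT, hper⟩ := hs
  exact ⟨n₀, T, hT, fun n hn => by simpa [s] using! congrFun (hper n hn) 0⟩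

theorem exists_content_pow_add_eq (B : Matrix ι ι ℤ) (hB : ∀ n, B ^ n ≠ 0) :
    ∃ n₀ T a : ℕ, 0 < T ∧ a ≠ 0 ∧
      ∀ n, n₀ ≤ n → (B ^ (n + T)).content = a * (B ^ n).content := by
  obtain ⟨e, c, he, hc, hint, hdvd⟩ := exists_isIntegral_inv_smul_pow B hB
  obtain ⟨d, p, X, hX, hrec⟩ := exists_recurrence (B ^ e) hc hint
  set k := c ^ d
  have hk : k ≠ 0 := pow_ne_zero _ hc
  have : NeZero (k * c) := ⟨mul_ne_zero hk hc⟩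
  obtain ⟨n₀, T, hT, hper⟩ := eventuallyPeriodic_map_of_recurrence (q := k * c) hrec
  have hmul : ∀ r n, c ^ n * (B ^ r * X n).content = k * (B ^ (r + e * n)).content := fun r n => by
    rw [← content_smul, ← content_smul, ← mul_smul_comm, hX, mul_smul_comm, ← pow_mul, pow_add]
  have hbd : ∀ r < e, ∀ n, (B ^ r * X n).content ∣ k * c := fun r hr n => by
    refine Nat.dvd_of_mul_dvd_mul_left (pow_pos (Nat.pos_of_ne_zero hc) n) ?_
    rw [hmul, mul_left_comm]
    refine mul_dvd_mul_left _ ?_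
    rw [← pow_succ]
    refine dvd_trans ?_ (hdvd (n + 1))
    have : e * (n + 1) = (r + e * n) + (e - r) := by rw [mul_add]; omega
    rw [this, pow_add B _ (e - r)]
    exact content_dvd_content_mul_left _ _
  have hcong : ∀ r n, n₀ ≤ n → ∀ i j,
      ((k * c : ℕ) : ℤ) ∣ (B ^ r * X (n + T)) i j - (B ^ r * X n) i j := fun r n hn i j => by
    rw [← sub_apply, ← mul_sub]
    refine Finset.dvd_sum fun l _ => Dvd.dvd.mul_left ?_ _
    have := congrFun (congrFun (hper n hn) l) j
    exact Int.modEq_iff_dvd.1 ((ZMod.intCast_eq_intCast_iff _ _ _).1 this.symm)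
  refine ⟨e * n₀ + e, e * T, c ^ T, Nat.mul_pos he hT, pow_ne_zero _ hc, fun N hN => ?_⟩
  obtain ⟨r, n, hr, rfl⟩ : ∃ r n, r < e ∧ N = r + e * n :=
    ⟨N % e, N / e, Nat.mod_lt _ he, (Nat.mod_add_div N e).symm⟩
  have hn : n₀ ≤ n := by
    by_contra hlt
    have : e * n ≤ e * n₀ := Nat.mul_le_mul_left _ (by omega)
    omega
  have heq : (B ^ r * X (n + T)).content = (B ^ r * X n).content := by
    refine Nat.dvd_antisymm ?_ ?_
    · refine content_dvd_content_of_forall_dvd_sub (hbd r hr _) fun i j => ?_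
      rw [← dvd_neg, neg_sub]; exact hcong r n hn i j
    · exact content_dvd_content_of_forall_dvd_sub (hbd r hr _) (hcong r n hn)
  refine Nat.eq_of_mul_eq_mul_left (Nat.pos_of_ne_zero hk) ?_
  rw [add_assoc, ← mul_add, ← hmul, heq, pow_add, mul_comm (c ^ n), mul_assoc, hmul, mul_left_comm]

end Matrix

namespace Matrix

variable {ι : Type*} [Fintype ι] [DecidableEq ι]

/-- Two integer matrices are equivalent if they agree up to multiplication on both sides by
unimodular matrices. -/
def UnimodularEquiv (M N : Matrix ι ι ℤ) : Prop :=
  ∃ U V : Matrix ι ι ℤ, IsUnit U.det ∧ IsUnit V.det ∧ M = U * N * V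

namespace UnimodularEquiv

theorem refl (M : Matrix ι ι ℤ) : UnimodularEquiv M M := ⟨1, 1, by simp, by simp, by simp⟩

theorem symm {M N : Matrix ι ι ℤ} : UnimodularEquiv M N → UnimodularEquiv N M := by
  rintro ⟨U, V, hU, hV, rfl⟩
  refine ⟨U⁻¹, V⁻¹, by simpa using hU, by simpa using hV, ?_⟩
  rw [mul_assoc, mul_assoc, mul_assoc, mul_nonsing_inv _ hV, mul_one, ← mul_assoc,
    nonsing_inv_mul _ hU, one_mul]

theorem trans {M N P : Matrix ι ι ℤ} :
    UnimodularEquiv M N → UnimodularEquiv N P → UnimodularEquiv M P := by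
  rintro ⟨U, V, hU, hV, rfl⟩ ⟨U', V', hU', hV', rfl⟩
  exact ⟨U * U', V' * V, by simp only [det_mul]; exact hU.mul hU',
    by simp only [det_mul]; exact hV'.mul hV, by simp only [mul_assoc]⟩

theorem mul_left {U : Matrix ι ι ℤ} (hU : IsUnit U.det) (M : Matrix ι ι ℤ) :
    UnimodularEquiv (U * M) M := ⟨U, 1, hU, by simp, by simp⟩

theorem mul_right {V : Matrix ι ι ℤ} (hV : IsUnit V.det) (M : Matrix ι ι ℤ) :
    UnimodularEquiv (M * V) M := ⟨1, V, by simp, hV, by simp⟩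

theorem submatrix {κ : Type*} [Fintype κ] [DecidableEq κ] {M N : Matrix ι ι ℤ}
    (h : UnimodularEquiv M N) (e : κ ≃ ι) :
    UnimodularEquiv (M.submatrix e e) (N.submatrix e e) := by
  obtain ⟨U, V, hU, hV, rfl⟩ := h
  exact ⟨U.submatrix e e, V.submatrix e e, by simpa using hU, by simpa using hV,
    by simp only [submatrix_mul_equiv]⟩

theorem submatrix_perm (M : Matrix ι ι ℤ) (σ τ : Equiv.Perm ι) :
    UnimodularEquiv (M.submatrix σ τ) M := by
  refine ⟨(1 : Matrix ι ι ℤ).submatrix σ id, (1 : Matrix ι ι ℤ).submatrix id τ, ?_, ?_, ?_⟩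
  · rw [det_permute]; simp
  · rw [det_permute']; simp
  · ext i j
    simp [mul_apply, one_apply]

theorem content_eq {M N : Matrix ι ι ℤ} (h : UnimodularEquiv M N) : M.content = N.content := by
  have aux : ∀ {M N : Matrix ι ι ℤ}, UnimodularEquiv M N → N.content ∣ M.content := by
    rintro M N ⟨U, V, -, -, rfl⟩
    exact (content_dvd_content_mul_right U N).trans (content_dvd_content_mul_left _ _)
  exact Nat.dvd_antisymm (aux h.symm) (aux h)

end UnimodularEquiv

/-- A nonzero integer matrix is equivalent to one having an entry that divides all entries. -/
theorem exists_unimodularEquiv_forall_dvd (M : Matrix ι ι ℤ) (hM : M ≠ 0) :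
    ∃ (N : Matrix ι ι ℤ) (i j : ι), UnimodularEquiv M N ∧ ∀ i' j', N i j ∣ N i' j' := by
  obtain ⟨i₀, j₀, h₀⟩ : ∃ i j, M i j ≠ 0 := by
    by_contra! h
    exact hM (by ext i j; exact h i j)
  have hex : ∃ n, ∃ (N : Matrix ι ι ℤ) (i j : ι),
      UnimodularEquiv M N ∧ N i j ≠ 0 ∧ (N i j).natAbs = n :=
    ⟨_, M, i₀, j₀, .refl M, h₀, rfl⟩
  classical
  obtain ⟨N, i, j, hMN, hne, hmin⟩ := Nat.find_spec hex
  have hle : ∀ (N' : Matrix ι ι ℤ) (i' j' : ι), UnimodularEquiv M N' → N' i' j' ≠ 0 →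
      (N i j).natAbs ≤ (N' i' j').natAbs := fun N' i' j' h h' => by
    rw [hmin]; exact Nat.find_min' hex ⟨N', i', j', h, h', rfl⟩
  have hmod : ∀ x : ℤ, x % N i j ≠ 0 → (x % N i j).natAbs < (N i j).natAbs := fun x _ => by
    have h1 := Int.emod_nonneg x hne
    have h2 := Int.emod_lt_abs x hne
    rw [Int.abs_eq_natAbs] at h2
    omega
  have hcol : ∀ (N' : Matrix ι ι ℤ) (k l : ι), UnimodularEquiv M N' → N' k l = N i j →
      ∀ k', N' k l ∣ N' k' l := by
    intro N' k l hN' hkl k'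
    by_cases hk : k' = k
    · rw [hk]
    rw [hkl]
    by_contra hnd
    rw [Int.dvd_iff_emod_eq_zero] at hnd
    have hval : (transvection k' k (-(N' k' l / N i j)) * N') k' l = N' k' l % N i j := by
      rw [transvection_mul_apply_same, hkl]
      have := Int.emod_add_mul_ediv (N' k' l) (N i j)
      linarith
    refine absurd (hle (transvection k' k (-(N' k' l / N i j)) * N') k' l
      (hN'.trans (UnimodularEquiv.mul_left ?_ _).symm) ?_) (not_le.2 ?_)
    · simp [det_transvection_of_ne _ _ hk]
    · rw [hval]; exact hnd
    · rw [hval]; exact hmod _ hnd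
  have hrow : ∀ (N' : Matrix ι ι ℤ) (k l : ι), UnimodularEquiv M N' → N' k l = N i j →
      ∀ l', N' k l ∣ N' k l' := by
    intro N' k l hN' hkl l'
    by_cases hl : l' = l
    · rw [hl]
    rw [hkl]
    by_contra hnd
    rw [Int.dvd_iff_emod_eq_zero] at hnd
    have hval : (N' * transvection l l' (-(N' k l' / N i j))) k l' = N' k l' % N i j := by
      rw [mul_transvection_apply_same, hkl]
      have := Int.emod_add_mul_ediv (N' k l') (N i j)
      linarith
    refine absurd (hle (N' * transvection l l' (-(N' k l' / N i j))) k l'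
      (hN'.trans (UnimodularEquiv.mul_right ?_ _).symm) ?_) (not_le.2 ?_)
    · simp [det_transvection_of_ne _ _ (Ne.symm hl)]
    · rw [hval]; exact hnd
    · rw [hval]; exact hmod _ hnd
  refine ⟨N, i, j, hMN, fun i' j' => ?_⟩
  by_cases hi : i' = i
  · rw [hi]; exact hrow N i j hMN rfl j'
  obtain ⟨q, hq⟩ := hcol N i j hMN rfl i'
  have hval : (transvection i' i (1 - q) * N) i' j = N i j := by
    rw [transvection_mul_apply_same, hq]; ring
  have := hrow (transvection i' i (1 - q) * N) i' j
    (hMN.trans (UnimodularEquiv.mul_left (by simp [det_transvection_of_ne _ _ hi]) _).symm) hval j'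
  rw [hval, transvection_mul_apply_same] at this
  exact (dvd_add_left ((hrow N i j hMN rfl j').mul_left _)).1 this

theorem exists_unimodularEquiv_fromBlocks {κ : Type*} [Fintype κ] [DecidableEq κ]
    (M : Matrix (Unit ⊕ κ) (Unit ⊕ κ) ℤ)
    (h : ∀ i j, M (Sum.inl ()) (Sum.inl ()) ∣ M i j) :
    ∃ M' : Matrix κ κ ℤ, UnimodularEquiv M
      (fromBlocks (diagonal fun _ => M (Sum.inl ()) (Sum.inl ())) 0 0
        (M (Sum.inl ()) (Sum.inl ()) • M')) := by
  choose f hf using h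
  set a := M (Sum.inl ()) (Sum.inl ())
  refine ⟨of fun i j => f (Sum.inr i) (Sum.inr j) - f (Sum.inr i) (Sum.inl ()) *
    f (Sum.inl ()) (Sum.inr j),
    fromBlocks 1 0 (of fun i j => f (Sum.inr i) (Sum.inl j)) 1,
    fromBlocks 1 (of fun i j => f (Sum.inl i) (Sum.inr j)) 0 1, by simp, by simp, ?_⟩
  rw [fromBlocks_multiply, fromBlocks_multiply]
  ext (i | i) (j | j)
  · simp [a]
  · simp only [fromBlocks_apply₁₂, one_mul, zero_mul, mul_one, add_apply, zero_apply,
      mul_zero, mul_apply, diagonal_apply, of_apply]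
    simp [hf (Sum.inl i) (Sum.inr j)]
  · simp [mul_apply, hf (Sum.inr i) (Sum.inl j), mul_comm]
  · simp [mul_apply, hf (Sum.inr i) (Sum.inr j)]
    ring

theorem exists_unimodularEquiv_diagonal (n : ℕ) (M : Matrix (Fin n) (Fin n) ℤ) :
    ∃ s : Fin n → ℤ, (∀ i j, i ≤ j → s i ∣ s j) ∧ UnimodularEquiv M (diagonal s) := by
  induction n with
  | zero => exact ⟨0, fun i => i.elim0, by rw [Subsingleton.elim M (diagonal 0)]; exact .refl _⟩
  | succ n ih =>
    by_cases hM : M = 0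
    · exact ⟨0, fun _ _ _ => dvd_rfl, by rw [hM]; simpa using UnimodularEquiv.refl _⟩
    obtain ⟨N, i, j, hMN, hdvd⟩ := exists_unimodularEquiv_forall_dvd M hM
    let e : Unit ⊕ Fin n ≃ Fin (n + 1) := (Equiv.sumComm _ _).trans
      ((Equiv.optionEquivSumPUnit _).symm.trans (finSuccEquiv n).symm)
    have he0 : e.symm 0 = Sum.inl () := by simp [e]
    have hes : ∀ k : Fin n, e.symm k.succ = Sum.inr k := fun k => by simp [e]
    set N₁ := N.submatrix (Equiv.swap i 0) (Equiv.swap j 0) with hN₁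
    set N₂ := N₁.submatrix e e with hN₂
    have h00 : N₂ (Sum.inl ()) (Sum.inl ()) = N i j := by
      rw [← he0]; simp [hN₂, hN₁]
    obtain ⟨M', hM'⟩ := exists_unimodularEquiv_fromBlocks N₂
      (fun i' j' => by rw [h00]; exact hdvd _ _)
    rw [h00] at hM'
    obtain ⟨s, hs, U, V, hU, hV, rfl⟩ := ih M'
    set a := N i j
    have hblock : UnimodularEquiv
        (fromBlocks (diagonal fun _ : Unit => a) 0 0 (a • (U * diagonal s * V)))
        (diagonal (Sum.elim (fun _ => a) (a • s))) := by
      refine ⟨fromBlocks 1 0 0 U, fromBlocks 1 0 0 V, by simpa using hU, by simpa using hV, ?_⟩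
      rw [← fromBlocks_diagonal, fromBlocks_multiply, fromBlocks_multiply, diagonal_smul]
      simp [-zsmul_eq_mul]
    have htot := (hM'.trans hblock).submatrix e.symm
    rw [hN₂, submatrix_submatrix, Equiv.self_comp_symm, submatrix_id_id,
      submatrix_diagonal_equiv] at htot
    refine ⟨_, ?_, (hMN.trans (UnimodularEquiv.submatrix_perm N _ _).symm).trans htot⟩
    intro i j
    refine Fin.cases ?_ (fun i => ?_) i <;> refine Fin.cases ?_ (fun j => ?_) j <;> intro hij
    · exact dvd_rfl
    · simp [he0, hes]
    · simp at hij
    · simpa [hes] using mul_dvd_mul_left a (hs i j (Fin.succ_le_succ_iff.1 hij))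

theorem dvd_of_diagonal_eq_mul {m : ℕ} {s t : Fin m → ℤ} {P Q : Matrix (Fin m) (Fin m) ℤ}
    (hs : ∀ i j, i ≤ j → s i ∣ s j) (ht : ∀ i j, i ≤ j → t i ∣ t j)
    (h : diagonal t = P * diagonal s * Q) (k : Fin m) : s k ∣ t k := by
  choose! u hu using fun i (hi : i ≤ k) => ht i k hi
  let N : Matrix (Fin m) (Fin m) ℤ := of fun i j =>
    if i ≤ k then if j < k then u i * P i j else 0 else if i = j then 1 else 0
  have hdet : N.det = 0 := by
    refine det_eq_zero_of_column_eq_zero k fun i => ?_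
    simp only [N, of_apply, lt_irrefl, if_false]
    split_ifs with h1 h2
    · rfl
    · exact absurd h2.le h1
    · rfl
  obtain ⟨v, hv0, hv⟩ := exists_vecMul_eq_zero_iff.2 hdet
  obtain ⟨i₀, hi₀⟩ := Function.ne_iff.1 hv0
  obtain ⟨w, hw, hw1⟩ := Finset.extract_gcd v ⟨i₀, Finset.mem_univ _⟩
  have hg : Finset.univ.gcd v ≠ 0 := fun h0 => hi₀ (by
    rw [hw i₀ (Finset.mem_univ _), h0, zero_mul]; rfl)
  have hwN : ∀ j, ∑ i, w i * N i j = 0 := fun j => by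
    have := congrFun hv j
    simp only [vecMul, dotProduct, Pi.zero_apply] at this
    refine (mul_eq_zero.1 ?_).resolve_left hg
    rw [Finset.mul_sum, ← this]
    refine Finset.sum_congr rfl fun i hi => ?_
    rw [hw i hi, mul_assoc]
  have hsupp : ∀ j, ¬ j ≤ k → w j = 0 := fun j hj => by
    rw [← hwN j, Finset.sum_eq_single j]
    · simp [N, hj]
    · intro i _ hij
      simp only [N, of_apply, hij, if_false, not_lt.2 (not_le.1 hj).le, ite_self, mul_zero]
    · simp
  have hker : ∀ j < k, ∑ i, w i * u i * P i j = 0 := fun j hj => by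
    rw [← hwN j]
    refine Finset.sum_congr rfl fun i _ => ?_
    by_cases hi : i ≤ k
    · simp [N, hi, hj, mul_assoc]
    · simp [hsupp i hi]
  have hdvd : ∀ i, s k ∣ w i * t k := fun i => by
    by_cases hi : i ≤ k
    swap
    · simp [hsupp i hi]
    have h1 : w i * t k = ∑ l, w l * u l * (diagonal t) l i := by
      rw [Finset.sum_eq_single i]
      · rw [diagonal_apply_eq, hu i hi]; ring
      · intro l _ hl; simp [diagonal_apply_ne _ hl]
      · simp
    have h2 : ∑ l, w l * u l * (diagonal t) l i =
        ∑ j, (∑ l, w l * u l * P l j) * s j * Q j i := by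
      rw [h]
      simp only [mul_apply (M := P * diagonal s), mul_diagonal, Finset.mul_sum, Finset.sum_mul]
      rw [Finset.sum_comm]
      refine Finset.sum_congr rfl fun j _ => Finset.sum_congr rfl fun l _ => by ring
    rw [h1, h2]
    refine Finset.dvd_sum fun j _ => ?_
    rcases lt_or_ge j k with hj | hj
    · simp [hker j hj]
    · exact ((hs k j hj).mul_left _).mul_right _
  have := Finset.dvd_gcd (s := Finset.univ) (f := fun i => w i * t k) fun i _ => hdvd i
  rw [Finset.gcd_mul_right, hw1, one_mul] at this
  exact this.trans (normalize_associated _).dvd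

end Matrix

namespace IsSmithForm

open Matrix

variable {m : ℕ} {M S : Matrix (Fin m) (Fin m) ℤ}

theorem dvd_of_le (h : IsSmithForm M S) (i j : Fin m) (hij : i ≤ j) : S i i ∣ S j j := by
  obtain ⟨j, hj⟩ := j
  obtain ⟨d, rfl⟩ := Nat.exists_eq_add_of_le (show (i : ℕ) ≤ j from hij)
  induction d with
  | zero => exact dvd_rfl
  | succ d ih =>
    exact (ih (by omega) (by simp [Fin.le_def])).trans (h.dvd ⟨i + d, by omega⟩ _ rfl)

theorem diagonal_diag (h : IsSmithForm M S) : diagonal (fun i => S i i) = S :=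
  h.isDiag.diagonal_diag

theorem unimodularEquiv (h : IsSmithForm M S) : UnimodularEquiv M S := h.equiv

theorem dvd_mul_left {S' : Matrix (Fin m) (Fin m) ℤ} {A : Matrix (Fin m) (Fin m) ℤ}
    (h : IsSmithForm M S) (h' : IsSmithForm (A * M) S') (k : Fin m) : S k k ∣ S' k k := by
  obtain ⟨U, V, -, -, hUV⟩ := h.equiv
  obtain ⟨U', V', -, -, hUV'⟩ := h'.unimodularEquiv.symm
  refine dvd_of_diagonal_eq_mul (s := fun i => S i i) (t := fun i => S' i i)
    (P := U' * A * U) (Q := V * V') h.dvd_of_le h'.dvd_of_le ?_ k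
  rw [h.diagonal_diag, h'.diagonal_diag, hUV', hUV]
  simp only [mul_assoc]

theorem unique {S' : Matrix (Fin m) (Fin m) ℤ} (h : IsSmithForm M S) (h' : IsSmithForm M S') :
    S = S' := by
  rw [← h.diagonal_diag, ← h'.diagonal_diag]
  congr 1
  funext i
  have h1 : IsSmithForm (1 * M) S := by rwa [one_mul]
  have h1' : IsSmithForm (1 * M) S' := by rwa [one_mul]
  exact Int.dvd_antisymm (h.nonneg i) (h'.nonneg i) (h.dvd_mul_left h1' i) (h'.dvd_mul_left h1 i)

theorem exists_isSmithForm (M : Matrix (Fin m) (Fin m) ℤ) : ∃ S, IsSmithForm M S := by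
  obtain ⟨s, hs, hM⟩ := exists_unimodularEquiv_diagonal m M
  let ε : Fin m → ℤ := fun i => if 0 ≤ s i then 1 else -1
  have hε : ∀ i, s i = ε i * |s i| := fun i => by
    by_cases h : 0 ≤ s i
    · simp [ε, h, abs_of_nonneg h]
    · simp [ε, h, abs_of_neg (not_le.1 h)]
  have hdet : IsUnit (diagonal ε).det := by
    rw [det_diagonal, IsUnit.prod_univ_iff]
    intro i
    by_cases h : 0 ≤ s i <;> simp [ε, h]
  refine ⟨diagonal fun i => |s i|, isDiag_diagonal _, fun i => by simp, fun i j hij => ?_, ?_⟩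
  · simpa [abs_dvd_abs] using hs i j (by rw [Fin.le_def]; omega)
  · refine hM.trans ?_
    have := UnimodularEquiv.mul_left hdet (diagonal fun i => |s i|)
    rwa [diagonal_mul_diagonal, ← funext hε] at this

end IsSmithForm

namespace Matrix

open Set.powersetCard

variable {m : ℕ}

/-- The `k`-th compound of a square matrix, whose entries are the minors of size `k`. -/
noncomputable def compound (k : ℕ) (M : Matrix (Fin m) (Fin m) ℤ) :
    Matrix (Set.powersetCard (Fin m) k) (Set.powersetCard (Fin m) k) ℤ :=
  LinearMap.toMatrix ((Pi.basisFun ℤ (Fin m)).exteriorPower k)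
    ((Pi.basisFun ℤ (Fin m)).exteriorPower k) (exteriorPower.map k (toLin' M))

theorem compound_mul (k : ℕ) (M N : Matrix (Fin m) (Fin m) ℤ) :
    compound k (M * N) = compound k M * compound k N := by
  rw [compound, toLin'_mul, exteriorPower.map_comp]
  exact LinearMap.toMatrix_comp _ _ _ _ _

theorem compound_one (k : ℕ) : compound k (1 : Matrix (Fin m) (Fin m) ℤ) = 1 := by
  rw [compound, toLin'_one, exteriorPower.map_id, LinearMap.toMatrix_id]

theorem compound_pow (k : ℕ) (M : Matrix (Fin m) (Fin m) ℤ) (n : ℕ) :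
    compound k (M ^ n) = compound k M ^ n := by
  induction n with
  | zero => rw [pow_zero, pow_zero, compound_one]
  | succ n ih => rw [pow_succ, pow_succ, compound_mul, ih]

theorem compound_diagonal (k : ℕ) (s : Fin m → ℤ) :
    compound k (diagonal s) = diagonal fun t => ∏ i, s (ofFinEmbEquiv.symm t i) := by
  ext t t'
  rw [compound, LinearMap.toMatrix_apply, exteriorPower.basis_apply,
    exteriorPower.map_apply_ιMulti_family]
  have : exteriorPower.ιMulti_family ℤ k (toLin' (diagonal s) ∘ Pi.basisFun ℤ (Fin m)) t' =
      (∏ i, s (ofFinEmbEquiv.symm t' i)) •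
        exteriorPower.ιMulti_family ℤ k (Pi.basisFun ℤ (Fin m)) t' := by
    rw [exteriorPower.ιMulti_family, exteriorPower.ιMulti_family, ← AlternatingMap.map_smul_univ]
    congr 1
    funext i
    ext j
    simp [Pi.single_apply]
  rw [this, map_smul, exteriorPower.basis_repr, Finsupp.smul_apply, diagonal_apply,
    Finsupp.single_apply]
  by_cases h : t = t'
  · simp [h]
  · simp [h, Ne.symm h]

theorem UnimodularEquiv.compound {M N : Matrix (Fin m) (Fin m) ℤ} (h : UnimodularEquiv M N)
    (k : ℕ) : UnimodularEquiv (M.compound k) (N.compound k) := by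
  have aux : ∀ {U : Matrix (Fin m) (Fin m) ℤ}, IsUnit U.det → IsUnit (U.compound k).det :=
    fun {U} hU => by
      refine IsUnit.of_mul_eq_one (U⁻¹.compound k).det ?_
      rw [← det_mul, ← compound_mul, mul_nonsing_inv _ hU, compound_one, det_one]
  obtain ⟨U, V, hU, hV, rfl⟩ := h
  exact ⟨_, _, aux hU, aux hV, by rw [compound_mul, compound_mul]⟩

end Matrix

theorem Fin.castLE_le_of_strictMono {k m : ℕ} (hk : k ≤ m) {f : Fin k → Fin m} (hf : StrictMono f)
    (i : Fin k) : Fin.castLE hk i ≤ f i := by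
  obtain ⟨j, hj⟩ := i
  rw [Fin.le_def]
  induction j with
  | zero => exact Nat.zero_le _
  | succ j ih =>
    have h1 := ih (by omega)
    have h2 : f ⟨j, by omega⟩ < f ⟨j + 1, hj⟩ := hf (by simp)
    rw [Fin.lt_def] at h2
    simp only [Fin.val_castLE] at h1 ⊢
    omega

open Matrix

theorem IsSmithForm.content_compound {m : ℕ} {M S : Matrix (Fin m) (Fin m) ℤ}
    (h : IsSmithForm M S) {k : ℕ} (hk : k ≤ m) :
    (M.compound k).content =
      ∏ i : Fin k, (S (Fin.castLE hk i) (Fin.castLE hk i)).natAbs := by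
  rw [(h.unimodularEquiv.compound k).content_eq, ← h.diagonal_diag, compound_diagonal]
  simp only [h.diagonal_diag]
  refine Nat.dvd_antisymm ?_ ?_
  · let t := Set.powersetCard.ofFinEmbEquiv (Fin.castLEOrderEmb hk)
    have := content_dvd (diagonal fun t : Set.powersetCard (Fin m) k =>
      ∏ i, S (Set.powersetCard.ofFinEmbEquiv.symm t i)
        (Set.powersetCard.ofFinEmbEquiv.symm t i)) t t
    rw [diagonal_apply_eq, Equiv.symm_apply_apply, Int.natCast_dvd, ← Int.natAbsHom_apply,
      map_prod] at this
    exact this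
  · refine dvd_content_iff.2 fun t t' => ?_
    rw [diagonal_apply]
    split_ifs
    · rw [Int.natCast_dvd, ← Int.natAbsHom_apply, map_prod]
      refine Finset.prod_dvd_prod_of_dvd _ _ fun i _ => ?_
      refine Int.natAbs_dvd_natAbs.2 (h.dvd_of_le _ _ ?_)
      exact Fin.castLE_le_of_strictMono hk (Set.powersetCard.ofFinEmbEquiv.symm t).strictMono i
    · exact dvd_zero _

theorem EventuallyPeriodic.pi {ι α : Type*} [Finite ι] {f : ι → ℕ → α}
    (h : ∀ i, EventuallyPeriodic (f i)) : EventuallyPeriodic fun n i => f i n := by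
  have := Fintype.ofFinite ι
  choose n₀ T hT hper using h
  refine ⟨∑ i, n₀ i, ∏ i, T i, Finset.prod_pos fun i _ => hT i, fun n hn => funext fun i => ?_⟩
  have hi : n₀ i ≤ n :=
    (Finset.single_le_sum (fun _ _ => Nat.zero_le _) (Finset.mem_univ i)).trans hn
  obtain ⟨c, hc⟩ := Finset.dvd_prod_of_mem T (Finset.mem_univ i)
  rw [hc]
  clear hc
  change f i (n + T i * c) = f i n
  induction c with
  | zero => simp
  | succ c ih => rw [mul_add, mul_one, ← add_assoc, hper i _ (by omega), ih]

theorem eq_pow_mul_of_forall_add_eq_mul {d : ℕ → ℕ} {n₀ T a : ℕ}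
    (h : ∀ n, n₀ ≤ n → d (n + T) = a * d n) (k n : ℕ) (hn : n₀ ≤ n) :
    d (n + k * T) = a ^ k * d n := by
  induction k with
  | zero => simp
  | succ k ih =>
    rw [add_mul, one_mul, ← add_assoc, h _ (by omega), ih, pow_succ', mul_assoc]

theorem eventuallyPeriodic_smithForm_div {m : ℕ} {A : Matrix (Fin m) (Fin m) ℤ}
    {S : ℕ → Matrix (Fin m) (Fin m) ℤ} (hS : ∀ n, IsSmithForm (A ^ n) (S n)) (i : Fin m) :
    EventuallyPeriodic fun n => S (n + 1) i i / S n i i := by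
  have hdvd : ∀ n (j : Fin m), S n j j ∣ S (n + 1) j j := fun n j =>
    (hS n).dvd_mul_left (A := A) (by rw [← pow_succ']; exact hS (n + 1)) j
  by_cases hz : ∃ N, S N i i = 0
  · obtain ⟨N, hN⟩ := hz
    have hzero : ∀ n, N ≤ n → S n i i = 0 := fun n hn => by
      induction n, hn using Nat.le_induction with
      | base => exact hN
      | succ n _ ih => exact zero_dvd_iff.1 (ih ▸ hdvd n i)
    refine ⟨N, 1, one_pos, fun n hn => ?_⟩
    simp only [hzero n hn, hzero (n + 1) (by omega), Int.ediv_zero]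
  push Not at hz
  have hne : ∀ n (j : Fin m), j ≤ i → S n j j ≠ 0 := fun n j hj h0 =>
    hz n (zero_dvd_iff.1 (h0 ▸ (hS n).dvd_of_le j i hj))
  have hi : (i : ℕ) ≤ m := i.2.le
  have hcont : ∀ k, k ≤ (i : ℕ) + 1 → ∀ n, (A.compound k ^ n).content ≠ 0 := fun k hk n => by
    rw [← compound_pow, (hS n).content_compound (by omega), Finset.prod_ne_zero_iff]
    exact fun j _ => Int.natAbs_ne_zero.2 (hne n _ (by rw [Fin.le_def, Fin.val_castLE]; omega))
  have hsucc : ∀ n, (A.compound (i + 1) ^ n).content =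
      (A.compound i ^ n).content * (S n i i).natAbs := fun n => by
    rw [← compound_pow, ← compound_pow, (hS n).content_compound (show (i : ℕ) + 1 ≤ m from i.2),
      (hS n).content_compound hi, Fin.prod_univ_castSucc]
    rfl
  obtain ⟨n₀, T, a, hT, ha, hper⟩ := exists_content_pow_add_eq (A.compound i)
    fun n h0 => hcont i (by omega) n (content_eq_zero_iff.2 h0)
  obtain ⟨n₁, T', a', hT', ha', hper'⟩ := exists_content_pow_add_eq (A.compound (i + 1))
    fun n h0 => hcont (i + 1) le_rfl n (content_eq_zero_iff.2 h0)
  have hscale : ∀ n, n₀ + n₁ ≤ n →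
      ((a ^ T' : ℕ) : ℤ) * S (n + T * T') i i = ((a' ^ T : ℕ) : ℤ) * S n i i := fun n hn => by
    have h1 := eq_pow_mul_of_forall_add_eq_mul
      (d := fun n => (A.compound i ^ n).content) hper T' n (by omega)
    have h2 := eq_pow_mul_of_forall_add_eq_mul
      (d := fun n => (A.compound (i + 1) ^ n).content) hper' T n (by omega)
    simp only [mul_comm T' T] at h1 h2
    rw [hsucc, hsucc, h1] at h2
    have h3 : a ^ T' * (S (n + T * T') i i).natAbs = a' ^ T * (S n i i).natAbs := by
      refine Nat.eq_of_mul_eq_mul_left (Nat.pos_of_ne_zero (hcont i (by omega) n)) ?_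
      linarith
    rw [← Int.natAbs_of_nonneg ((hS (n + T * T')).nonneg i),
      ← Int.natAbs_of_nonneg ((hS n).nonneg i)]
    exact_mod_cast h3
  refine ⟨n₀ + n₁, T * T', Nat.mul_pos hT hT', fun n hn => ?_⟩
  obtain ⟨δ, hδ⟩ := hdvd n i
  have haT : ((a ^ T' : ℕ) : ℤ) ≠ 0 := by exact_mod_cast pow_ne_zero _ ha
  have h1 : S (n + T * T' + 1) i i = S (n + T * T') i i * δ := by
    refine mul_left_cancel₀ haT ?_
    rw [add_right_comm, hscale (n + 1) (by omega), hδ, ← mul_assoc, ← mul_assoc, hscale n hn]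
  simp only [h1, hδ]
  rw [Int.mul_ediv_cancel_left _ (hz _), Int.mul_ediv_cancel_left _ (hz _)]

theorem theorem1 (m : ℕ) (A : Matrix (Fin m) (Fin m) ℤ) :
    (∀ n : ℕ, ∃! S : Matrix (Fin m) (Fin m) ℤ, IsSmithForm (A ^ n) S) ∧
      ∀ S : ℕ → Matrix (Fin m) (Fin m) ℤ, (∀ n : ℕ, IsSmithForm (A ^ n) (S n)) →
        ∃ D : ℕ → Matrix (Fin m) (Fin m) ℤ,
          EventuallyPeriodic D ∧ (∀ n : ℕ, (D n).IsDiag) ∧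
            ∀ n : ℕ, S (n + 1) = D n * S n := by
  refine ⟨fun n => ?_, fun S hS => ?_⟩
  · obtain ⟨S, hS⟩ := IsSmithForm.exists_isSmithForm (A ^ n)
    exact ⟨S, hS, fun S' hS' => hS'.unique hS⟩
  refine ⟨fun n => diagonal fun i => S (n + 1) i i / S n i i, ?_, fun n => isDiag_diagonal _,
    fun n => ?_⟩
  · obtain ⟨n₀, T, hT, hper⟩ := EventuallyPeriodic.pi (eventuallyPeriodic_smithForm_div hS)
    exact ⟨n₀, T, hT, fun n hn => congrArg diagonal (hper n hn)⟩
  · have hdvd : ∀ i, S n i i ∣ S (n + 1) i i :=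
      (hS n).dvd_mul_left (A := A) (by rw [← pow_succ']; exact hS (n + 1))
    conv_lhs => rw [← (hS (n + 1)).diagonal_diag]
    conv_rhs => rw [← (hS n).diagonal_diag, diagonal_mul_diagonal]
    congr 1
    funext i
    exact (Int.ediv_mul_cancel (hdvd i)).symm
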